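/- Let $n\ge 2$. For $a_1,\dots,a_{n-1}>0$ and $b_1,\dots,b_n\in\mathbb R$ let $\mathcal J$ be the real symmetric tridiagonal $n\times n$ matrix with diagonal entries $b_1,\dots,b_n$ and off-diagonal entries $\mathcal J_{j,j+1}=\mathcal J_{j+1,j}=a_j$. For $l\in\mathbb R$ and $m>0$ let $\mathcal J_{l,m}$ be the matrix obtained from $\mathcal J$ by replacing the $(1,1)$-entry $b_1$ by $b_1+il$ and the $(2,1)$-entry $a_1$ by $a_1+im$. Eigenvalues are counted with algebraic multiplicity, and the spectrum is the multiset of eigenvalues. Let $\operatorname{Arg}z\in(-\pi,\pi]$ be the principal argument, and put $\operatorname{Arg}_{[0,\pi)}z=\operatorname{Arg}z$ if $\operatorname{Im}z>0$, $\operatorname{Arg}_{[0,\pi)}z=0$ if $z\in\mathbb R$, and $\operatorname{Arg}_{[0,\pi)}z=\pi+\operatorname{Arg}z$ if $\operatorname{Im}z<0$. For $\xi\in\mathbb R$ and $A>0$ let $\mathcal Z(\xi,A)$ be the set of unordered configurations $\{z_j\}_{j=1}^{n-1}$ of points of $\mathbb C\setminus\mathbb R$ (repetitions allowed) such that $$\sum_{j=1}^{n-1}\operatorname{Arg}_{[0,\pi)}(z_j-\xi)<\arctan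 A .$$ **Theorem 5.4.** 1. Let $m>0$, $l\in\mathbb R$, $\xi=b_1-\frac{l a_1}{m}$, and suppose $\det(\mathcal J-\xi I)=0$. Then $\xi$ is a simple eigenvalue of $\mathcal J_{l,m}$, and the remaining $n-1$ eigenvalues form a configuration in $\mathcal Z(\xi,A)$ with $A=\frac{m}{a_1}$. 2. Conversely, let $\xi\in\mathbb R$ and $A>0$. For each configuration $\{z_j\}_{j=1}^{n-1}\in\mathcal Z(\xi,A)$ there is a unique matrix $\mathcal J_{l,m}$ (with $a_j>0$, $b_j\in\mathbb R$, $m>0$, $l\in\mathbb R$) such that $b_1-\frac{l a_1}{m}=\xi$, $\frac{m}{a_1}=A$, $\det(\mathcal J-\xi I)=0$, and the spectrum of $\mathcal J_{l,m}$ consists of $\xi,z_1,\dots,z_{n-1}$. 3. In the situation of part 1, the number of eigenvalues of $\mathcal J$ greater than $\xi$ (respectively, less than $\xi$) equals the number of eigenvalues of $\mathcal J_{l,m}$ in the open upper half-plane $\mathbb C_+$ (respectively, in the open lower half-plane $\mathbb C_-$). -/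

import Mathlib

open Complex

/-- `Arg_{[0,π)}`: the argument of a complex number modulo `π`. It is `Arg z` in the open upper
half-plane, `0` on the real line and `π + Arg z` in the open lower half-plane, where
`Arg z ∈ (-π, π]` is the principal argument. -/
noncomputable def argModPi (z : ℂ) : ℝ :=
  if 0 < z.im then arg z else if z.im < 0 then Real.pi + arg z else 0

/-- The real Jacobi (symmetric tridiagonal) matrix of size `N + 1` with diagonal
`b 0, …, b N` and off-diagonal entries `a 0, …, a (N - 1)`. -/
def jacobiMatrix {N : ℕ} (a : Fin N → ℝ) (b : Fin (N + 1) → ℝ) :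
    Matrix (Fin (N + 1)) (Fin (N + 1)) ℝ :=
  fun i j =>
    if i = j then b i
    else if h : i.val + 1 = j.val then a ⟨i.val, by omega⟩
    else if h : j.val + 1 = i.val then a ⟨j.val, by omega⟩
    else 0

/-- The data of a matrix `J_{l,m}` of size `n = k + 2 ≥ 2`: a Jacobi matrix with positive
off-diagonal entries `a` and real diagonal `b` (indexed from `0`, so that `a 0` and `b 0` are
the usual `a₁` and `b₁`), a real number `l` and a positive number `m`. -/
structure RankTwoData (k : ℕ) where
  a : Fin (k + 1) → ℝ
  b : Fin (k + 2) → ℝ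
  l : ℝ
  m : ℝ
  a_pos : ∀ j, 0 < a j
  m_pos : 0 < m

namespace RankTwoData

/-- The unperturbed Jacobi matrix `J`. -/
def J {k : ℕ} (P : RankTwoData k) : Matrix (Fin (k + 2)) (Fin (k + 2)) ℝ :=
  jacobiMatrix P.a P.b

/-- The perturbed matrix `J_{l,m}`: the `(1,1)`-entry `b₁` of `J` becomes `b₁ + il` and the
`(2,1)`-entry `a₁` becomes `a₁ + im`. -/
noncomputable def Jlm {k : ℕ} (P : RankTwoData k) : Matrix (Fin (k + 2)) (Fin (k + 2)) ℂ :=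
  P.J.map (fun x : ℝ => (x : ℂ)) + Matrix.single 0 0 (I * P.l) + Matrix.single 1 0 (I * P.m)

/-- `ξ = b₁ - l a₁ / m`. -/
noncomputable def xi {k : ℕ} (P : RankTwoData k) : ℝ := P.b 0 - P.l * P.a 0 / P.m

/-- `A = m / a₁`. -/
noncomputable def ratio {k : ℕ} (P : RankTwoData k) : ℝ := P.m / P.a 0

end RankTwoData

/-- The spectrum of a square matrix, as the multiset of its eigenvalues counted with algebraic
multiplicity. -/
noncomputable def eigenvalueMultiset {K : Type*} [Field K] {n : ℕ} (M : Matrix (Fin n) (Fin n) K) :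
    Multiset K :=
  M.charpoly.roots

/-- The unordered configurations of `N` non-real points `z₁, …, z_N`, repetitions allowed, with
`∑ Arg_{[0,π)} (z_j - ξ) < arctan A`. -/
def configurations (N : ℕ) (ξ A : ℝ) : Set (Multiset ℂ) :=
  {s | Multiset.card s = N ∧ (∀ z ∈ s, z.im ≠ 0) ∧
    (s.map fun z => argModPi (z - (ξ : ℂ))).sum < Real.arctan A}

/-! Let `p` be the characteristic polynomial of `J` and `q` that of its first minor. Expanding along
the first row gives the characteristic polynomial of `J_{l,m}` as `p + iA(p - (X - ξ)q)`. If `p = (X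
- ξ)U`, it factors as `(X - ξ)(U + iV)` with `V = A(U - q)`, so the remaining eigenvalues are the
roots `z_j` of `G = U + iV`.

On the real line `φ(x) = ∑ Arg_{[0,π)}(z_j - x)` is a continuous phase of `G`, up to sign. It is
positive and tends to `π` times the number of `z_j` in the upper (lower) half-plane as `x → +∞`
(`-∞`). Zeros of `U` are the points where `φ` meets `π/2` modulo `π`, and the sign of `U'V` there
tells the direction. Positive residues of `q/p` at the zeros of `U` mean that `φ` crosses upwards as
`x` moves away from `ξ` on either side. Counting crossings shows that this, for a real-rooted `U`,
amounts to `φ(ξ) < π/2`, and it also matches the half-plane counts (`rootPhase_lt_and_counts`,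
`splits_of_rootPhase_lt`). The residue at `ξ` is positive exactly when `V/U < A` there, that is,
`φ(ξ) < arctan A`.

For Jacobi matrices the residues are positive by a Wronskian recursion (`jacobi_wronskian_pos`).
Conversely, the Euclidean algorithm rebuilds a unique Jacobi matrix from such a pair `p, q`
(`exists_jacobiMatrix`, `jacobiMatrix_unique`), and `ξ, A` then fix `l, m`. -/

/-! ### Continuous phases of plane curves and crossing counts -/

theorem abs_sub_int_mul_pi_lt_of_ordConnected {φ : ℝ → ℝ} (hφ : Continuous φ) {s : Set ℝ}
    (hs : s.OrdConnected) (hcos : ∀ x ∈ s, Real.cos (φ x) ≠ 0) {k : ℤ} {c x : ℝ} (hc : c ∈ s)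
    (hk : |φ c - k * Real.pi| < Real.pi / 2) (hx : x ∈ s) :
    |φ x - k * Real.pi| < Real.pi / 2 := by
  by_contra! h
  have hcont : ContinuousOn (fun y => |φ y - k * Real.pi|) s := by fun_prop
  obtain ⟨y, hy, hyk⟩ := hs.isPreconnected.intermediate_value hc hx hcont ⟨hk.le, h⟩
  apply hcos y hy
  rw [Real.cos_eq_zero_iff]
  rcases abs_eq (by positivity) |>.1 hyk with h | h
  · exact ⟨k, by linarith⟩
  · exact ⟨k - 1, by push_cast; linarith⟩

theorem cos_ne_zero_of_abs_sub_int_mul_pi_lt {θ : ℝ} {k : ℤ}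
    (h : |θ - k * Real.pi| < Real.pi / 2) : Real.cos θ ≠ 0 := by
  have h1 : 0 < Real.cos (θ - k * Real.pi) :=
    Real.cos_pos_of_mem_Ioo ⟨by linarith [(abs_lt.1 h).1], (abs_lt.1 h).2⟩
  rw [Real.cos_sub_int_mul_pi] at h1
  intro h0
  simp [h0] at h1

theorem exists_abs_sub_int_mul_pi_lt {θ : ℝ} (h : Real.cos θ ≠ 0) :
    ∃ k : ℤ, |θ - k * Real.pi| < Real.pi / 2 := by
  have hpi := Real.pi_pos
  refine ⟨round (θ / Real.pi), ?_⟩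
  have h1 := abs_sub_round (θ / Real.pi)
  have h2 : θ - round (θ / Real.pi) * Real.pi = (θ / Real.pi - round (θ / Real.pi)) * Real.pi := by
    field_simp
  have h3 : |θ - round (θ / Real.pi) * Real.pi| ≤ Real.pi / 2 := by
    rw [h2, abs_mul, abs_of_pos hpi]
    nlinarith
  refine lt_of_le_of_ne h3 fun h4 => h ?_
  rw [Real.cos_eq_zero_iff]
  rcases abs_eq (by positivity) |>.1 h4 with h | h
  · exact ⟨round (θ / Real.pi), by linarith⟩
  · exact ⟨round (θ / Real.pi) - 1, by push_cast; linarith⟩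

/-- `φ` is a continuous phase of the planar curve `(u, v)`, up to sign. -/
structure IsPhase (u v φ : ℝ → ℝ) : Prop where
  diff_left : Differentiable ℝ u
  diff_right : Differentiable ℝ v
  cont : Continuous φ
  polar : ∀ x, ∃ r : ℝ, r ≠ 0 ∧ u x = r * Real.cos (φ x) ∧ v x = r * Real.sin (φ x)

namespace IsPhase

variable {u v φ : ℝ → ℝ}

theorem cos_ne_zero_iff (h : IsPhase u v φ) (x : ℝ) : Real.cos (φ x) ≠ 0 ↔ u x ≠ 0 := by
  obtain ⟨r, hr, hu, -⟩ := h.polar x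
  simp [hu, hr]

/-- The product `u v` is `r² / 2 · sin 2φ`, which does not see the sign of `r`. -/
theorem mul_pos_iff (h : IsPhase u v φ) {k : ℤ} {x : ℝ}
    (hk : |φ x - k * Real.pi| < Real.pi / 2) : 0 < u x * v x ↔ 0 < φ x - k * Real.pi := by
  obtain ⟨r, hr, hu, hv⟩ := h.polar x
  obtain ⟨hk1, hk2⟩ := abs_lt.1 hk
  have hsin : u x * v x = r ^ 2 / 2 * Real.sin (2 * (φ x - k * Real.pi)) := by
    rw [show 2 * (φ x - k * Real.pi) = 2 * φ x - k * (2 * Real.pi) by ring,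
      Real.sin_sub_int_mul_two_pi, Real.sin_two_mul, hu, hv]
    ring
  have hr2 : 0 < r ^ 2 / 2 := by positivity
  rw [hsin, mul_pos_iff_of_pos_left hr2]
  constructor
  · intro h0
    by_contra! h1
    exact absurd h0 (not_lt.2 (Real.sin_nonpos_of_nonpos_of_neg_pi_le (by linarith) (by linarith)))
  · intro h0
    exact Real.sin_pos_of_pos_of_lt_pi (by linarith) (by linarith)

/-- Conjugation `(v, φ) ↦ (-v, -φ)` reduces this to `mul_pos_iff`. -/
theorem mul_neg_iff (h : IsPhase u v φ) {k : ℤ} {x : ℝ}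
    (hk : |φ x - k * Real.pi| < Real.pi / 2) : u x * v x < 0 ↔ φ x - k * Real.pi < 0 := by
  have h' : IsPhase u (-v) (-φ) :=
    ⟨h.diff_left, h.diff_right.neg, h.cont.neg, fun x => by
      obtain ⟨r, hr, hu, hv⟩ := h.polar x
      exact ⟨r, hr, by simp [hu], by simp [hv]⟩⟩
  have := h'.mul_pos_iff (k := -k) (x := x) (by
    rw [← abs_neg]; simpa [sub_eq_add_neg, add_comm] using hk)
  simp only [Pi.neg_apply] at this
  push_cast at this
  constructor
  · intro h0; have := this.1 (by linarith); linarith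
  · intro h0; have := this.2 (by linarith); linarith

theorem comp_neg (h : IsPhase u v φ) :
    IsPhase (fun x => u (-x)) (fun x => v (-x)) (fun x => φ (-x)) :=
  ⟨h.diff_left.comp differentiable_neg, h.diff_right.comp differentiable_neg,
    h.cont.comp continuous_neg, fun x => h.polar (-x)⟩

/-- The change of the phase across an isolated zero of `u`. -/
theorem crossing (h : IsPhase u v φ) {c t d : ℝ} (hct : c < t) (htd : t < d) (hut : u t = 0)
    (huniq : ∀ x ∈ Set.Icc c d, u x = 0 → x = t) {k k' : ℤ}
    (hk : |φ c - k * Real.pi| < Real.pi / 2) (hk' : |φ d - k' * Real.pi| < Real.pi / 2) :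
    k' ≤ k + 1 ∧ (deriv u t * v t < 0 → k' = k + 1) ∧ (0 < deriv u t * v t → k' ≤ k) := by
  have hpi := Real.pi_pos
  -- With no zero of `u` on either side of `t`, the phase stays in one strip of width `π` on each
  -- side.
  have hL : ∀ x ∈ Set.Ico c t, |φ x - k * Real.pi| < Real.pi / 2 := fun x hx =>
    abs_sub_int_mul_pi_lt_of_ordConnected h.cont Set.ordConnected_Ico
      (fun y hy => (h.cos_ne_zero_iff y).2 fun h0 =>
        hy.2.ne (huniq y ⟨hy.1, (hy.2.trans htd).le⟩ h0)) ⟨le_rfl, hct⟩ hk hx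
  have hR : ∀ x ∈ Set.Ioc t d, |φ x - k' * Real.pi| < Real.pi / 2 := fun x hx =>
    abs_sub_int_mul_pi_lt_of_ordConnected h.cont Set.ordConnected_Ioc
      (fun y hy => (h.cos_ne_zero_iff y).2 fun h0 =>
        hy.1.ne' (huniq y ⟨(hct.trans hy.1).le, hy.2⟩ h0)) ⟨htd, le_rfl⟩ hk' hx
  have hLe : ∀ᶠ x in nhdsWithin t (Set.Iio t), x ∈ Set.Ico c t := Ico_mem_nhdsLT hct
  have hRe : ∀ᶠ x in nhdsWithin t (Set.Ioi t), x ∈ Set.Ioc t d := Ioc_mem_nhdsGT htd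
  have hφL : Filter.Tendsto φ (nhdsWithin t (Set.Iio t)) (nhds (φ t)) :=
    h.cont.continuousAt.tendsto.mono_left nhdsWithin_le_nhds
  have hφR : Filter.Tendsto φ (nhdsWithin t (Set.Ioi t)) (nhds (φ t)) :=
    h.cont.continuousAt.tendsto.mono_left nhdsWithin_le_nhds
  have hcos : Real.cos (φ t) = 0 := by
    by_contra h0; exact (h.cos_ne_zero_iff t).1 h0 hut
  have hne : ∀ j : ℤ, φ t ≠ j * Real.pi := fun j hj => by
    refine cos_ne_zero_of_abs_sub_int_mul_pi_lt (k := j) (θ := φ t) ?_ hcos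
    rw [hj]; simpa using hpi
  have hLle : φ t ≤ k * Real.pi + Real.pi / 2 := le_of_tendsto hφL
    (hLe.mono fun x hx => by linarith [(abs_lt.1 (hL x hx)).2])
  have hRge : k' * Real.pi - Real.pi / 2 ≤ φ t := ge_of_tendsto hφR
    (hRe.mono fun x hx => by linarith [(abs_lt.1 (hR x hx)).1])
  have hder : deriv (fun x => u x * v x) t = deriv u t * v t := by
    rw [deriv_fun_mul (h.diff_left t) (h.diff_right t), hut]; ring
  have hzero : (fun x => u x * v x) t = 0 := by simp [hut]
  refine ⟨?_, fun hneg => ?_, fun hpos => ?_⟩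
  · have : (k' : ℝ) * Real.pi ≤ (k + 1 : ℤ) * Real.pi := by push_cast; linarith
    exact_mod_cast le_of_mul_le_mul_right this hpi
  -- Here `u v` passes from positive to negative, so `φ` is above `kπ` just before `t` and below
  -- `k'π` just after. Since `φ t` is not a multiple of `π`, this forces `k < k'`.
  · have hs := eventually_nhdsWithin_sign_eq_of_deriv_neg
      (f := fun x => u x * v x) (by rwa [hder]) hzero
    have h1 : k * Real.pi ≤ φ t := by
      refine ge_of_tendsto hφL ?_
      filter_upwards [hLe, nhdsWithin_le_nhds hs] with x hx hsx
      rw [sign_pos (sub_pos.2 hx.2), sign_eq_one_iff] at hsx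
      linarith [(h.mul_pos_iff (hL x hx)).1 hsx]
    have h2 : φ t ≤ k' * Real.pi := by
      refine le_of_tendsto hφR ?_
      filter_upwards [hRe, nhdsWithin_le_nhds hs] with x hx hsx
      rw [sign_neg (sub_neg.2 hx.1), sign_eq_neg_one_iff] at hsx
      linarith [(h.mul_neg_iff (hR x hx)).1 hsx]
    have h3 : (k : ℝ) * Real.pi < k' * Real.pi :=
      (lt_of_le_of_ne h1 (hne k).symm).trans_le h2
    have h4 : k < k' := by exact_mod_cast lt_of_mul_lt_mul_right h3 hpi.le
    have : (k' : ℝ) * Real.pi ≤ (k + 1 : ℤ) * Real.pi := by push_cast; linarith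
    have h5 : k' ≤ k + 1 := by exact_mod_cast le_of_mul_le_mul_right this hpi
    omega
  · have hs := eventually_nhdsWithin_sign_eq_of_deriv_pos
      (f := fun x => u x * v x) (by rwa [hder]) hzero
    have h1 : φ t ≤ k * Real.pi := by
      refine le_of_tendsto hφL ?_
      filter_upwards [hLe, nhdsWithin_le_nhds hs] with x hx hsx
      rw [sign_neg (sub_neg.2 hx.2), sign_eq_neg_one_iff] at hsx
      linarith [(h.mul_neg_iff (hL x hx)).1 hsx]
    have h2 : k' * Real.pi ≤ φ t := by
      refine ge_of_tendsto hφR ?_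
      filter_upwards [hRe, nhdsWithin_le_nhds hs] with x hx hsx
      rw [sign_pos (sub_pos.2 hx.1), sign_eq_one_iff] at hsx
      linarith [(h.mul_pos_iff (hR x hx)).1 hsx]
    have h3 := h2.trans h1
    exact_mod_cast le_of_mul_le_mul_right h3 hpi

/-- Counting the zeros of `u` to the right of `c` by the increments of the phase. -/
theorem count_right (h : IsPhase u v φ) {n : ℤ}
    (hlim : Filter.Tendsto φ Filter.atTop (nhds (n * Real.pi))) (Z : Finset ℝ) :
    ∀ (c : ℝ) (k : ℤ), |φ c - k * Real.pi| < Real.pi / 2 →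
      (∀ x, x ∈ Z ↔ c < x ∧ u x = 0) →
      n ≤ k + (Z.filter fun x => ¬ 0 < deriv u x * v x).card ∧
      ((∀ x ∈ Z, deriv u x * v x < 0) → k + Z.card ≤ n) := by
  classical
  have hpi := Real.pi_pos
  -- The leftmost zero is peeled off and the base point `c` moves just past it.
  induction Z using Finset.induction_on_min with
  | empty =>
    intro c k hk hZ
    have hu : u c ≠ 0 := (h.cos_ne_zero_iff c).1 (cos_ne_zero_of_abs_sub_int_mul_pi_lt hk)
    have hall : ∀ x ∈ Set.Ici c, |φ x - k * Real.pi| < Real.pi / 2 := fun x hx =>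
      abs_sub_int_mul_pi_lt_of_ordConnected h.cont Set.ordConnected_Ici
        (fun y hy => (h.cos_ne_zero_iff y).2 fun h0 => by
          rcases eq_or_lt_of_le (Set.mem_Ici.1 hy) with rfl | hy'
          · exact hu h0
          · simpa using (hZ y).2 ⟨hy', h0⟩) (Set.mem_Ici.2 le_rfl) hk hx
    have hle : (n : ℝ) * Real.pi ≤ k * Real.pi + Real.pi / 2 := le_of_tendsto hlim
      ((Filter.eventually_ge_atTop c).mono fun x hx => by linarith [(abs_lt.1 (hall x hx)).2])
    have hge : (k : ℝ) * Real.pi - Real.pi / 2 ≤ n * Real.pi := ge_of_tendsto hlim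
      ((Filter.eventually_ge_atTop c).mono fun x hx => by linarith [(abs_lt.1 (hall x hx)).1])
    -- The limit only gives `|n - k| ≤ 1/2`, which suffices for integers.
    have h1 : (n : ℝ) < (k + 1 : ℤ) := by push_cast; nlinarith
    have h2 : (k : ℝ) < (n + 1 : ℤ) := by push_cast; nlinarith
    have h1' : n < k + 1 := by exact_mod_cast h1
    have h2' : k < n + 1 := by exact_mod_cast h2
    simp; omega
  | insert t Z hmin ih =>
    intro c k hk hZ
    have htZ : t ∉ Z := fun ht => lt_irrefl _ (hmin t ht)
    have hu : u c ≠ 0 := (h.cos_ne_zero_iff c).1 (cos_ne_zero_of_abs_sub_int_mul_pi_lt hk)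
    obtain ⟨hct, hut⟩ := (hZ t).1 (Finset.mem_insert_self _ _)
    obtain ⟨d, htd, hd⟩ : ∃ d, t < d ∧ ∀ x ∈ Z, d < x := by
      rcases Z.eq_empty_or_nonempty with rfl | hne
      · exact ⟨t + 1, by linarith, by simp⟩
      · obtain ⟨d, h1, h2⟩ := exists_between (hmin _ (Z.min'_mem hne))
        exact ⟨d, h1, fun x hx => h2.trans_le (Z.min'_le x hx)⟩
    have huniq : ∀ x ∈ Set.Icc c d, u x = 0 → x = t := fun x hx hx0 => by
      have hcx : c < x := lt_of_le_of_ne hx.1 fun h0 => hu (h0 ▸ hx0)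
      rcases Finset.mem_insert.1 ((hZ x).2 ⟨hcx, hx0⟩) with h1 | h1
      · exact h1
      · exact absurd (hd x h1) (not_lt.2 hx.2)
    have hud : u d ≠ 0 := fun h0 => htd.ne' (huniq d ⟨(hct.trans htd).le, le_rfl⟩ h0)
    obtain ⟨k', hk'⟩ := exists_abs_sub_int_mul_pi_lt ((h.cos_ne_zero_iff d).2 hud)
    obtain ⟨h1, h2, h3⟩ := h.crossing hct htd hut huniq hk hk'
    obtain ⟨ih1, ih2⟩ := ih d k' hk' fun x => by
      constructor
      · intro hx
        exact ⟨hd x hx, ((hZ x).1 (Finset.mem_insert_of_mem hx)).2⟩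
      · rintro ⟨hx, hx0⟩
        have := (hZ x).2 ⟨(hct.trans htd).trans hx, hx0⟩
        rcases Finset.mem_insert.1 this with h1 | h1
        · exact absurd (h1 ▸ hx) (not_lt.2 htd.le)
        · exact h1
    constructor
    · rw [Finset.filter_insert]
      split_ifs with hs
      · have := h3 hs
        omega
      · rw [Finset.card_insert_of_notMem (by simp [htZ])]
        push_cast
        omega
    · intro hall
      have hk1 := h2 (hall t (Finset.mem_insert_self _ _))
      have := ih2 fun x hx => hall x (Finset.mem_insert_of_mem hx)
      rw [Finset.card_insert_of_notMem htZ]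
      push_cast
      omega

/-- Counting the zeros of `u` to the left of `c` by the increments of the phase. -/
theorem count_left (h : IsPhase u v φ) {n : ℤ}
    (hlim : Filter.Tendsto φ Filter.atBot (nhds (n * Real.pi))) (Z : Finset ℝ)
    (c : ℝ) (k : ℤ) (hk : |φ c - k * Real.pi| < Real.pi / 2)
    (hZ : ∀ x, x ∈ Z ↔ x < c ∧ u x = 0) :
    n ≤ k + (Z.filter fun x => ¬ deriv u x * v x < 0).card ∧
      ((∀ x ∈ Z, 0 < deriv u x * v x) → k + Z.card ≤ n) := by
  classical
  have hd : ∀ x, deriv (fun x => u (-x)) x * v (-x) = - (deriv u (-x) * v (-x)) := fun x => by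
    rw [deriv_comp_neg]; ring
  obtain ⟨h1, h2⟩ := h.comp_neg.count_right (n := n) (hlim.comp Filter.tendsto_neg_atTop_atBot)
    (Z.map (Equiv.neg ℝ).toEmbedding) (-c) k (by simpa using hk) (fun x => by
      simp only [Finset.mem_map_equiv, Equiv.neg_symm, Equiv.neg_apply, hZ]
      constructor <;> rintro ⟨h1, h2⟩ <;> exact ⟨by linarith, h2⟩)
  rw [Finset.filter_map, Finset.card_map] at h1
  rw [Finset.card_map] at h2
  simp only [hd] at h1 h2
  refine ⟨?_, fun hall => h2 fun x hx => ?_⟩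
  · convert h1 using 5 with x
    simp
  · have := hall (-x) (by simpa using hx)
    linarith

end IsPhase

/-! ### The phase of a polynomial with non-real roots -/

/-- One formula serves both half-planes, because `re / im` is invariant under `z ↦ -z`. Continuity
and limits of the phase follow from those of `arctan`. -/
theorem argModPi_eq (z : ℂ) (hz : z.im ≠ 0) :
    argModPi z = Real.pi / 2 - Real.arctan (z.re / z.im) := by
  have key : ∀ w : ℂ, 0 < w.im → arg w = Real.pi / 2 - Real.arctan (w.re / w.im) := by
    intro w hw
    rw [arg_of_im_pos hw, Real.arccos_eq_pi_div_two_sub_arcsin, Real.arctan_eq_arcsin]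
    congr 2
    rw [norm_eq_sqrt_sq_add_sq]
    have : w.re ^ 2 + w.im ^ 2 = w.im ^ 2 * (1 + (w.re / w.im) ^ 2) := by
      field_simp; ring
    rw [this, Real.sqrt_mul (by positivity), Real.sqrt_sq hw.le]
    field_simp
  unfold argModPi
  rcases lt_or_gt_of_ne hz with h | h
  · rw [if_neg (not_lt.2 h.le), if_pos h]
    have h1 := key (-z) (by simpa using h)
    rw [arg_neg_eq_arg_add_pi_of_im_neg h] at h1
    rw [add_comm, h1]
    simp
  · rw [if_pos h, key z h]

theorem argModPi_pos {z : ℂ} (hz : z.im ≠ 0) : 0 < argModPi z := by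
  rw [argModPi_eq z hz]
  linarith [Real.arctan_lt_pi_div_two (z.re / z.im)]

theorem exists_eq_mul_exp_argModPi {z : ℂ} (hz : z.im ≠ 0) :
    ∃ r : ℝ, r ≠ 0 ∧ z = r * exp (argModPi z * I) := by
  set t := z.re / z.im with ht
  have hs : 0 < √(1 + t ^ 2) := by positivity
  refine ⟨z.im * √(1 + t ^ 2), by positivity, ?_⟩
  rw [argModPi_eq z hz, exp_mul_I, ← ofReal_cos, ← ofReal_sin, Real.cos_pi_div_two_sub,
    Real.sin_pi_div_two_sub, Real.sin_arctan, Real.cos_arctan]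
  apply Complex.ext
  · simp [← ht]
    rw [ht]; field_simp
  · simp [← ht]
    field_simp

/-- The phase `∑ Arg_{[0,π)} (z_j - x)` of the polynomial `∏ (x - z_j)` on the real line. -/
noncomputable def rootPhase (s : Multiset ℂ) (x : ℝ) : ℝ :=
  (s.map fun z => argModPi (z - (x : ℂ))).sum

theorem rootPhase_zero : rootPhase 0 = fun _ => 0 := by
  ext x; simp [rootPhase]

theorem rootPhase_cons (z : ℂ) (s : Multiset ℂ) :
    rootPhase (z ::ₘ s) = fun x : ℝ => argModPi (z - (x : ℂ)) + rootPhase s x := by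
  ext x; simp [rootPhase]

theorem argModPi_sub_ofReal {z : ℂ} (hz : z.im ≠ 0) (x : ℝ) :
    argModPi (z - (x : ℂ)) = Real.pi / 2 - Real.arctan ((z.re - x) / z.im) := by
  rw [argModPi_eq _ (by simpa using hz)]; simp

theorem continuous_rootPhase {s : Multiset ℂ} (hs : ∀ z ∈ s, z.im ≠ 0) :
    Continuous (rootPhase s) := by
  induction s using Multiset.induction_on with
  | empty => simp [rootPhase_zero, continuous_const]
  | cons z s ih =>
    rw [rootPhase_cons]
    have hz := hs z (Multiset.mem_cons_self _ _)
    simp only [argModPi_sub_ofReal hz]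
    have := ih fun w hw => hs w (Multiset.mem_cons_of_mem hw)
    have h2 := Real.continuous_arctan
    fun_prop

theorem rootPhase_pos {s : Multiset ℂ} (hs : ∀ z ∈ s, z.im ≠ 0) (h0 : s ≠ 0) (x : ℝ) :
    0 < rootPhase s x := by
  induction s using Multiset.induction_on with
  | empty => simp at h0
  | cons z s ih =>
    have hz := argModPi_pos (z := z - (x : ℂ)) (by simpa using hs z (Multiset.mem_cons_self _ _))
    rw [rootPhase_cons]
    rcases eq_or_ne s 0 with rfl | h
    · simpa [rootPhase] using hz
    · exact add_pos hz (ih (fun w hw => hs w (Multiset.mem_cons_of_mem hw)) h)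

/-- Arguments modulo `π` add up under multiplication once a real factor of either sign is allowed.
-/
theorem exists_prod_sub_eq_mul_exp_rootPhase {s : Multiset ℂ} (hs : ∀ z ∈ s, z.im ≠ 0) (x : ℝ) :
    ∃ r : ℝ, r ≠ 0 ∧ (s.map fun z => (x : ℂ) - z).prod = r * exp (rootPhase s x * I) := by
  induction s using Multiset.induction_on with
  | empty => exact ⟨1, one_ne_zero, by simp [rootPhase]⟩
  | cons z s ih =>
    obtain ⟨r, hr, h⟩ := ih fun w hw => hs w (Multiset.mem_cons_of_mem hw)
    obtain ⟨r', hr', h'⟩ := exists_eq_mul_exp_argModPi (z := z - (x : ℂ))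
      (by simpa using hs z (Multiset.mem_cons_self _ _))
    refine ⟨-(r' * r), by simp [hr, hr'], ?_⟩
    rw [Multiset.map_cons, Multiset.prod_cons, h, rootPhase_cons]
    push_cast
    rw [add_mul, exp_add]
    linear_combination (-(r * exp (rootPhase s x * I))) * h'

/-- As `x → +∞`, a root in the upper half-plane contributes `π` and one in the lower half-plane
contributes `0`. -/
theorem tendsto_rootPhase_atTop {s : Multiset ℂ} (hs : ∀ z ∈ s, z.im ≠ 0) :
    Filter.Tendsto (rootPhase s) Filter.atTop
      (nhds (((s.countP fun z => 0 < z.im : ℕ) : ℤ) * Real.pi)) := by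
  induction s using Multiset.induction_on with
  | empty => simp [rootPhase_zero]
  | cons z s ih =>
    have hz := hs z (Multiset.mem_cons_self _ _)
    have h1 := ih fun w hw => hs w (Multiset.mem_cons_of_mem hw)
    rw [rootPhase_cons]
    simp only [argModPi_sub_ofReal hz]
    have hlin : Filter.Tendsto (fun x : ℝ => z.re - x) Filter.atTop Filter.atBot :=
      Filter.tendsto_atBot_add_const_left _ _ Filter.tendsto_neg_atTop_atBot
    rcases lt_or_gt_of_ne hz with h | h
    · have h2 := Real.tendsto_arctan_atTop.mono_right nhdsWithin_le_nhds |>.comp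
        (hlin.atBot_mul_const_of_neg (inv_lt_zero.2 h))
      rw [Multiset.countP_cons_of_neg (p := fun z : ℂ => 0 < z.im) _ (not_lt.2 h.le)]
      convert (h2.const_sub (Real.pi / 2)).add h1 using 2
      · simp [div_eq_mul_inv]
      · simp
    · have h2 := Real.tendsto_arctan_atBot.mono_right nhdsWithin_le_nhds |>.comp
        (hlin.atBot_div_const h)
      simp only [Function.comp_def] at h2
      rw [Multiset.countP_cons_of_pos (p := fun z : ℂ => 0 < z.im) _ h]
      convert (h2.const_sub (Real.pi / 2)).add h1 using 2
      push_cast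
      ring

theorem tendsto_rootPhase_atBot {s : Multiset ℂ} (hs : ∀ z ∈ s, z.im ≠ 0) :
    Filter.Tendsto (rootPhase s) Filter.atBot
      (nhds (((s.countP fun z => z.im < 0 : ℕ) : ℤ) * Real.pi)) := by
  -- Negating the roots swaps the half-planes and reflects the real line.
  have h1 := tendsto_rootPhase_atTop (s := s.map fun z => -z) (by simpa using hs)
  have h2 : rootPhase s = rootPhase (s.map fun z => -z) ∘ fun x => -x := by
    ext x
    simp only [rootPhase, Function.comp, Multiset.map_map]
    refine congrArg _ (Multiset.map_congr rfl fun z hz => ?_)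
    rw [argModPi_sub_ofReal (hs z hz), argModPi_sub_ofReal (by simpa using hs z hz)]
    congr 2
    simp only [neg_re, neg_im]
    rw [← neg_div_neg_eq]
    ring_nf
  rw [h2]
  convert h1.comp Filter.tendsto_neg_atBot_atTop using 4
  rw [Multiset.countP_map, Multiset.countP_eq_card_filter]
  simp

/-! ### Characteristic polynomials of tridiagonal matrices -/

namespace Matrix

-- Expansion along the first row, then the first column. No symmetry is assumed, so it applies to
-- `J_{l,m}` as well as to `J`.
open Polynomial in
theorem charpoly_of_tridiagonal_corner {R : Type*} [CommRing R] {n : ℕ}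
    (M : Matrix (Fin (n + 2)) (Fin (n + 2)) R)
    (hrow : ∀ j : Fin n, M 0 j.succ.succ = 0) (hcol : ∀ i : Fin n, M i.succ.succ 0 = 0) :
    M.charpoly = (X - C (M 0 0)) * (M.submatrix Fin.succ Fin.succ).charpoly
      - C (M 0 1 * M 1 0) *
        ((M.submatrix Fin.succ Fin.succ).submatrix Fin.succ Fin.succ).charpoly := by
  have hsub : ∀ {m : ℕ} (A : Matrix (Fin (m + 1)) (Fin (m + 1)) R),
      (charmatrix A).submatrix Fin.succ Fin.succ = charmatrix (A.submatrix Fin.succ Fin.succ) := by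
    intro m A
    ext1 i j
    simp [charmatrix_apply, Matrix.diagonal_apply]
  rw [charpoly, det_succ_row_zero, Fin.sum_univ_succ, Fin.sum_univ_succ, Finset.sum_eq_zero]
  · have h0 : (charmatrix M).submatrix Fin.succ (Fin.succAbove 0)
        = charmatrix (M.submatrix Fin.succ Fin.succ) := by
      rw [Fin.succAbove_zero, hsub]
    have h1 : ((charmatrix M).submatrix Fin.succ (Fin.succAbove (Fin.succ 0))).det
        = charmatrix M 1 0 *
          ((M.submatrix Fin.succ Fin.succ).submatrix Fin.succ Fin.succ).charpoly := by
      rw [det_succ_column_zero, Fin.sum_univ_succ, Finset.sum_eq_zero]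
      · simp only [Fin.val_zero, pow_zero, one_mul, submatrix_apply, add_zero]
        rw [charpoly, ← hsub, ← hsub]
        congr 1
      · intro i _
        simp [hcol]
    rw [h0, h1, charpoly, charpoly]
    simp
    ring
  · intro j _
    have : charmatrix M 0 j.succ.succ = 0 := by
      rw [charmatrix_apply_ne _ _ _ (Fin.succ_ne_zero _).symm, hrow, C_0, neg_zero]
    rw [this]
    simp

end Matrix

theorem jacobiMatrix_submatrix_succ {N : ℕ} (a : Fin (N + 1) → ℝ) (b : Fin (N + 2) → ℝ) :
    (jacobiMatrix a b).submatrix Fin.succ Fin.succ = jacobiMatrix (Fin.tail a) (Fin.tail b) := by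
  ext i j
  simp only [Matrix.submatrix_apply, jacobiMatrix, Fin.tail, Fin.succ_inj, Fin.val_succ,
    Nat.add_right_cancel_iff]
  rfl

theorem jacobiMatrix_isHermitian {N : ℕ} (a : Fin N → ℝ) (b : Fin (N + 1) → ℝ) :
    (jacobiMatrix a b).IsHermitian := by
  ext i j
  simp only [Matrix.conjTranspose_apply, star_trivial, jacobiMatrix]
  by_cases h : i = j
  · simp [h]
  · rw [if_neg h, if_neg (Ne.symm h)]
    split_ifs
    all_goals first | rfl | omega

/-- The characteristic polynomial of a Jacobi matrix with its first row and column deleted. -/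
noncomputable def jacobiMinorPoly {N : ℕ} (a : Fin N → ℝ) (b : Fin (N + 1) → ℝ) :
    Polynomial ℝ :=
  ((jacobiMatrix a b).submatrix Fin.succ Fin.succ).charpoly

theorem jacobiMinorPoly_succ {N : ℕ} (a : Fin (N + 1) → ℝ) (b : Fin (N + 2) → ℝ) :
    jacobiMinorPoly a b = (jacobiMatrix (Fin.tail a) (Fin.tail b)).charpoly := by
  rw [jacobiMinorPoly, jacobiMatrix_submatrix_succ]

open Polynomial in
theorem jacobiMatrix_charpoly_succ {N : ℕ} (a : Fin (N + 1) → ℝ) (b : Fin (N + 2) → ℝ) :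
    (jacobiMatrix a b).charpoly = (X - C (b 0)) * jacobiMinorPoly a b
      - C (a 0 ^ 2) * jacobiMinorPoly (Fin.tail a) (Fin.tail b) := by
  rw [Matrix.charpoly_of_tridiagonal_corner]
  · rw [jacobiMinorPoly, jacobiMinorPoly, jacobiMatrix_submatrix_succ]
    simp [jacobiMatrix, sq]
  · intro j; simp [jacobiMatrix, Fin.ext_iff]
  · intro j; simp [jacobiMatrix, Fin.ext_iff]

theorem jacobiMinorPoly_monic {N : ℕ} (a : Fin N → ℝ) (b : Fin (N + 1) → ℝ) :
    (jacobiMinorPoly a b).Monic := Matrix.charpoly_monic _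

theorem jacobiMinorPoly_natDegree {N : ℕ} (a : Fin N → ℝ) (b : Fin (N + 1) → ℝ) :
    (jacobiMinorPoly a b).natDegree = N := by
  simp [jacobiMinorPoly, Matrix.charpoly_natDegree_eq_dim]

open Polynomial in
theorem jacobiMatrix_charpoly_zero (a : Fin 0 → ℝ) (b : Fin 1 → ℝ) :
    (jacobiMatrix a b).charpoly = X - C (b 0) := by
  simp [Matrix.charpoly, Matrix.charmatrix, jacobiMatrix]

open Polynomial in
/-- The Wronskian of the characteristic polynomial of a Jacobi matrix and of its first minor is
positive on the real line. -/
theorem jacobi_wronskian_pos {N : ℕ} (a : Fin N → ℝ) (b : Fin (N + 1) → ℝ)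
    (ha : ∀ j, 0 < a j) (x : ℝ) :
    0 < (derivative (jacobiMatrix a b).charpoly).eval x * (jacobiMinorPoly a b).eval x
      - (jacobiMatrix a b).charpoly.eval x * (derivative (jacobiMinorPoly a b)).eval x := by
  induction N with
  | zero =>
    have h1 : jacobiMinorPoly a b = 1 := by simp [jacobiMinorPoly, Matrix.charpoly]
    simp [h1, jacobiMatrix_charpoly_zero]
  | succ N ih =>
    have h := ih (Fin.tail a) (Fin.tail b) fun j => ha _
    rw [← jacobiMinorPoly_succ] at h
    have ha0 := ha 0
    rw [jacobiMatrix_charpoly_succ]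
    simp only [derivative_sub, derivative_mul, derivative_X, derivative_C, eval_sub, eval_add,
      eval_mul, eval_X, eval_C, sub_zero, zero_mul, zero_add, one_mul]
    -- The Wronskian equals `q² + a₀² W`, where `q` is the first minor and `W` is the Wronskian of
    -- the truncated matrix.
    nlinarith [mul_pos (pow_pos ha0 2) h, sq_nonneg ((jacobiMinorPoly a b).eval x)]

namespace RankTwoData

open Polynomial

/-- The characteristic polynomial of `J_{l,m}` in terms of those of `J` and of its first minor. -/
theorem charpoly_Jlm {k : ℕ} (P : RankTwoData k) :
    P.Jlm.charpoly = P.J.charpoly.map ofRealHom + C (I * P.ratio) *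
      (P.J.charpoly - (X - C P.xi) * jacobiMinorPoly P.a P.b).map ofRealHom := by
  have hsub : P.Jlm.submatrix Fin.succ Fin.succ
      = (P.J.submatrix Fin.succ Fin.succ).map ofRealHom := by
    ext i j
    have h : (0 : Fin (k + 2)) ≠ j.succ := (Fin.succ_ne_zero j).symm
    simp [Jlm, Matrix.single, h]
  have ha := (P.a_pos 0).ne'
  have hm := P.m_pos.ne'
  rw [Matrix.charpoly_of_tridiagonal_corner, hsub, Matrix.submatrix_map, Matrix.charpoly_map,
    Matrix.charpoly_map, J, jacobiMatrix_charpoly_succ]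
  · rw [jacobiMinorPoly, jacobiMinorPoly, jacobiMatrix_submatrix_succ]
    have h00 : P.Jlm 0 0 = P.b 0 + I * P.l := by simp [Jlm, J, jacobiMatrix, Matrix.single]
    have h01 : P.Jlm 0 1 = P.a 0 := by simp [Jlm, J, jacobiMatrix, Matrix.single]
    have h10 : P.Jlm 1 0 = P.a 0 + I * P.m := by simp [Jlm, J, jacobiMatrix, Matrix.single]
    rw [h00, h01, h10]
    -- The perturbation changes `b₀` by `iA(b₀ - ξ)` and the product of the off-diagonal entries by
    -- `iA a₀²`. Both changes carry the factor `iA`.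
    have h1 : (P.ratio : ℂ) * (P.b 0 - P.xi) = P.l := by
      rw [ratio, xi]; push_cast
      have : (P.a 0 : ℂ) ≠ 0 := by exact_mod_cast ha
      have : (P.m : ℂ) ≠ 0 := by exact_mod_cast hm
      field_simp; ring
    have h2 : (P.ratio : ℂ) * P.a 0 ^ 2 = P.m * P.a 0 := by
      rw [ratio]; push_cast
      have : (P.a 0 : ℂ) ≠ 0 := by exact_mod_cast ha
      field_simp
    rw [← h1, mul_add (P.a 0 : ℂ), show (P.a 0 : ℂ) * (I * P.m) = I * (P.m * P.a 0) by ring, ← h2]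
    simp only [Polynomial.map_sub, Polynomial.map_mul, Polynomial.map_X, Polynomial.map_C, C_add,
      C_mul, C_sub, ofRealHom_eq_coe, Polynomial.map_pow, C_pow]
    ring
  · intro j; simp [Jlm, J, jacobiMatrix, Matrix.single, Fin.ext_iff]
  · intro j; simp [Jlm, J, jacobiMatrix, Matrix.single, Fin.ext_iff]

end RankTwoData

/-! ### Positive residues and the Euclidean algorithm -/

namespace Polynomial

/-- Lagrange interpolation at the nodes `S`. -/
theorem eq_sum_C_mul_nodal_erase {S : Finset ℝ} {q : ℝ[X]} (hq : q.degree < S.card) :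
    q = ∑ t ∈ S, C (q.eval t / (derivative (Lagrange.nodal S id)).eval t)
      * Lagrange.nodal (S.erase t) id := by
  refine eq_of_degrees_lt_of_eval_finset_eq S hq ?_ fun x hx => ?_
  · refine (degree_sum_le _ _).trans_lt ?_
    rw [Finset.sup_lt_iff (WithBot.bot_lt_coe _)]
    intro t ht
    rw [← smul_eq_C_mul]
    refine (degree_smul_le _ _).trans_lt ?_
    rw [Lagrange.degree_nodal, Finset.card_erase_of_mem ht]
    have := Finset.card_pos.2 ⟨t, ht⟩
    exact_mod_cast Nat.sub_lt this one_pos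
  · rw [eval_finsetSum, ← Finset.add_sum_erase _ _ hx, Finset.sum_eq_zero]
    · have h := Lagrange.eval_nodal_derivative_eval_node_eq (v := (id : ℝ → ℝ)) hx
      simp only [id] at h
      have hne : (Lagrange.nodal (S.erase x) id).eval x ≠ 0 := by
        apply Lagrange.eval_nodal_not_at_node
        intro i hi
        exact (Finset.ne_of_mem_erase hi).symm
      rw [eval_mul, eval_C, add_zero, h]
      field_simp
    · intro t ht
      have : (Lagrange.nodal (S.erase t) (id : ℝ → ℝ)).eval x = 0 :=
        Lagrange.eval_nodal_at_node (v := (id : ℝ → ℝ))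
          (Finset.mem_erase.2 ⟨(Finset.ne_of_mem_erase ht).symm, hx⟩)
      rw [eval_mul, this, mul_zero]

theorem eq_nodal_of_splits {p : ℝ[X]} (hp : p.Monic) (hs : p.Splits) (hn : p.roots.Nodup) :
    p = Lagrange.nodal p.roots.toFinset id := by
  conv_lhs => rw [hs.eq_prod_roots_of_monic hp]
  rw [Lagrange.nodal, Finset.prod, Multiset.toFinset_val, hn.dedup]
  rfl

theorem nodup_roots_of_derivative_ne_zero {p : ℝ[X]} (hp : p ≠ 0)
    (h : ∀ x, p.IsRoot x → (derivative p).eval x ≠ 0) : p.roots.Nodup := by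
  rw [Multiset.nodup_iff_count_le_one]
  intro x
  rw [count_roots]
  by_contra! h1
  obtain ⟨h2, h3⟩ := (one_lt_rootMultiplicity_iff_isRoot hp).1 h1
  exact h x h2 h3

/-- `p` has only real roots, and `q / p` has positive residues at all of them. -/
structure PositiveResidues (p q : ℝ[X]) : Prop where
  splits : p.Splits
  pos : ∀ x, p.IsRoot x → 0 < (derivative p).eval x * q.eval x

namespace PositiveResidues

variable {p q : ℝ[X]}

theorem nodup (h : PositiveResidues p q) (hp : p ≠ 0) : p.roots.Nodup :=
  nodup_roots_of_derivative_ne_zero hp fun x hx h0 => by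
    have := h.pos x hx; simp [h0] at this

/-- The partial fraction expansion of `q / p`, with denominators cleared. -/
theorem exists_expansion (h : PositiveResidues p q) (hp : p.Monic) (hq : q.degree < p.degree) :
    ∃ (S : Finset ℝ) (c : ℝ → ℝ), S.card = p.natDegree ∧ (∀ t ∈ S, 0 < c t) ∧
      p = Lagrange.nodal S id ∧ q = ∑ t ∈ S, C (c t) * Lagrange.nodal (S.erase t) id := by
  have hnod := h.nodup hp.ne_zero
  have hpS := eq_nodal_of_splits hp h.splits hnod
  have hcard : p.roots.toFinset.card = p.natDegree := by
    rw [Multiset.toFinset_card_of_nodup hnod, h.splits.natDegree_eq_card_roots]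
  have hq' : q.degree < p.roots.toFinset.card := by
    rw [hcard, ← degree_eq_natDegree hp.ne_zero]; exact hq
  have h1 := eq_sum_C_mul_nodal_erase hq'
  rw [← hpS] at h1
  refine ⟨p.roots.toFinset, fun t => q.eval t / (derivative p).eval t, hcard, fun t ht => ?_,
    hpS, h1⟩
  have hpos := h.pos t (isRoot_of_mem_roots (Multiset.mem_toFinset.1 ht))
  rcases pos_and_pos_or_neg_and_neg_of_mul_pos hpos with ⟨h1, h2⟩ | ⟨h1, h2⟩
  · exact div_pos h2 h1
  · exact div_pos_of_neg_of_neg h2 h1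

/-- The Wronskian is linear in `q`, and the Wronskian of `p` with `p / (X - t)` is the square of the
latter. -/
theorem wronskian_pos (h : PositiveResidues p q) (hp : p.Monic) (hq : q.degree < p.degree)
    (hdeg : p.natDegree ≠ 0) (x : ℝ) :
    0 < (derivative p).eval x * q.eval x - p.eval x * (derivative q).eval x := by
  obtain ⟨S, c, hcard, hc, hpS, hqS⟩ := h.exists_expansion hp hq
  have key : (derivative p).eval x * q.eval x - p.eval x * (derivative q).eval x
      = ∑ t ∈ S, c t * (Lagrange.nodal (S.erase t) id).eval x ^ 2 := by
    rw [hqS, derivative_sum, eval_finsetSum, eval_finsetSum, Finset.mul_sum, Finset.mul_sum,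
      ← Finset.sum_sub_distrib]
    refine Finset.sum_congr rfl fun t ht => ?_
    have hpt : p = (X - C t) * Lagrange.nodal (S.erase t) id := by
      rw [hpS]; exact Lagrange.nodal_eq_mul_nodal_erase ht
    rw [hpt]
    simp only [derivative_mul, derivative_sub, derivative_X, derivative_C, eval_mul, eval_add,
      eval_sub, eval_X, eval_C, eval_one, eval_zero]
    ring
  rw [key]
  have hne : S.Nonempty := by rw [← Finset.card_pos]; omega
  refine Finset.sum_pos' (fun t ht => mul_nonneg (hc t ht).le (sq_nonneg _)) ?_
  -- Some square is nonzero: at a node `x` take `t = x`, elsewhere any `t`.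
  have hex : ∃ t ∈ S, ∀ s ∈ S.erase t, x ≠ s := by
    by_cases hx : x ∈ S
    · exact ⟨x, hx, fun s hs => (Finset.ne_of_mem_erase hs).symm⟩
    · obtain ⟨t, ht⟩ := hne
      exact ⟨t, ht, fun s hs h0 => hx (h0 ▸ Finset.mem_of_mem_erase hs)⟩
  obtain ⟨t, ht, hts⟩ := hex
  have h0 : (Lagrange.nodal (S.erase t) id).eval x ≠ 0 :=
    Lagrange.eval_nodal_not_at_node hts
  exact ⟨t, ht, mul_pos (hc t ht) (by positivity)⟩

/-- Off the real line, `q / p = ∑ c_t / (z - t)` has imaginary part of sign opposite to that of `z`,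
so `q` has no non-real zero. -/
theorem splits_right (h : PositiveResidues p q) (hp : p.Monic) (hq : q.degree < p.degree)
    (hdeg : p.natDegree ≠ 0) : q.Splits := by
  obtain ⟨S, c, hcard, hc, hpS, hqS⟩ := h.exists_expansion hp hq
  refine Splits.of_splits_map_of_injective (i := ofRealHom) ofRealHom.injective
    (IsAlgClosed.splits _) fun z hz => ?_
  have hroot := isRoot_of_mem_roots hz
  suffices hz0 : z.im = 0 from ⟨z.re, by apply Complex.ext <;> simp [hz0]⟩
  by_contra him
  have hne : ∀ t : ℝ, z - t ≠ 0 := fun t h0 => him (by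
    have := congrArg Complex.im h0; simpa using this)
  have hprod : (q.map ofRealHom).eval z
      = (∏ s ∈ S, (z - s)) * ∑ t ∈ S, (c t : ℂ) * (z - t)⁻¹ := by
    conv_lhs => rw [hqS]
    rw [Polynomial.map_sum, eval_finsetSum, Finset.mul_sum]
    refine Finset.sum_congr rfl fun t ht => ?_
    have := hne t
    rw [← Finset.mul_prod_erase _ _ ht, Lagrange.nodal]
    simp only [Polynomial.map_mul, Polynomial.map_prod, Polynomial.map_sub, Polynomial.map_X,
      Polynomial.map_C, eval_mul, eval_prod, eval_sub, eval_X, eval_C, ofRealHom_eq_coe, id]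
    field_simp
  rw [IsRoot, hprod, mul_eq_zero, Finset.prod_eq_zero_iff] at hroot
  rcases hroot with ⟨t, -, ht⟩ | hsum
  · exact hne t ht
  have him_sum := congrArg Complex.im hsum
  rw [im_sum, zero_im] at him_sum
  have hterm : ∀ t ∈ S, ((c t : ℂ) * (z - t)⁻¹).im = z.im * -(c t / normSq (z - t)) := by
    intro t _
    simp [Complex.inv_im]
    ring
  rw [Finset.sum_congr rfl hterm, ← Finset.mul_sum, mul_eq_zero, or_iff_right him,
    Finset.sum_neg_distrib, neg_eq_zero] at him_sum
  have hne' : S.Nonempty := by rw [← Finset.card_pos]; omega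
  exact (Finset.sum_pos (fun t ht => div_pos (hc t ht) (normSq_pos.2 (hne t))) hne').ne' him_sum

/-- This coefficient is the sum of the residues. -/
theorem coeff_pos (h : PositiveResidues p q) (hp : p.Monic) {n : ℕ} (hdeg : p.natDegree = n + 1)
    (hq : q.degree < p.degree) : 0 < q.coeff n := by
  obtain ⟨S, c, hcard, hc, hpS, hqS⟩ := h.exists_expansion hp hq
  have : q.coeff n = ∑ t ∈ S, c t := by
    rw [hqS, finsetSum_coeff]
    refine Finset.sum_congr rfl fun t ht => ?_
    have hm := Lagrange.nodal_monic (s := S.erase t) (v := (id : ℝ → ℝ))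
    have hd := Lagrange.natDegree_nodal (s := S.erase t) (v := (id : ℝ → ℝ))
    rw [Finset.card_erase_of_mem ht, hcard, hdeg, Nat.add_sub_cancel] at hd
    rw [coeff_C_mul]
    have := hm.coeff_natDegree
    rw [hd] at this
    rw [this, mul_one]
  rw [this]
  exact Finset.sum_pos hc (by rw [← Finset.card_pos]; omega)

/-- One step of the Euclidean algorithm preserves positivity of the residues. -/
theorem exists_euclid_step (h : PositiveResidues p q) (hp : p.Monic) (hq : q.Monic) {n : ℕ}
    (hpn : p.natDegree = n + 2) (hqn : q.natDegree = n + 1) :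
    ∃ (b a : ℝ) (r : ℝ[X]), 0 < a ∧ r.Monic ∧ r.natDegree = n ∧
      p = (X - C b) * q - C (a ^ 2) * r ∧ PositiveResidues q r := by
  have hpc : p.coeff (n + 2) = 1 := by rw [← hpn]; exact hp.coeff_natDegree
  have hqc : q.coeff (n + 1) = 1 := by rw [← hqn]; exact hq.coeff_natDegree
  have hlt : q.degree < p.degree := by
    rw [degree_eq_natDegree hp.ne_zero, degree_eq_natDegree hq.ne_zero, hpn, hqn]
    exact_mod_cast Nat.lt_succ_self _
  -- This `b` cancels the coefficient of `X ^ (n + 1)` in `(X - b) q - p`.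
  set b := q.coeff n - p.coeff (n + 1) with hb
  set R := (X - C b) * q - p with hR
  have hRdeg : R.degree < (n + 1 : ℕ) := by
    rw [degree_lt_iff_coeff_zero]
    intro m hm
    obtain ⟨m, rfl⟩ := Nat.exists_eq_add_of_le' (show 1 ≤ m by omega)
    rw [hR, sub_mul, coeff_sub, coeff_sub, coeff_X_mul, coeff_C_mul]
    rcases (show m = n ∨ m = n + 1 ∨ n + 2 ≤ m by omega) with rfl | rfl | hm'
    · rw [hqc, hb]; ring
    · rw [hqc, hpc, coeff_eq_zero_of_natDegree_lt (p := q) (by omega)]; ring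
    · rw [coeff_eq_zero_of_natDegree_lt (p := q) (by omega),
        coeff_eq_zero_of_natDegree_lt (p := q) (by omega),
        coeff_eq_zero_of_natDegree_lt (p := p) (by omega)]
      ring
  have hqdeg : q.degree = (n + 1 : ℕ) := by rw [degree_eq_natDegree hq.ne_zero, hqn]
  have hRpos : PositiveResidues q R := by
    -- At a zero of `q` one has `R = -p`, so `q' R` is the Wronskian of `p` and `q`.
    refine ⟨h.splits_right hp hlt (by omega), fun x hx => ?_⟩
    have hw := h.wronskian_pos hp hlt (by omega) x
    rw [IsRoot] at hx
    rw [hR, eval_sub, eval_mul, hx]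
    rw [hx] at hw
    linarith
  have hα : 0 < R.coeff n := hRpos.coeff_pos hq hqn (by rwa [hqdeg])
  have hα' := hα.ne'
  have hRn : R.natDegree = n := natDegree_eq_of_le_of_coeff_ne_zero
    (Nat.lt_succ_iff.1 ((natDegree_lt_iff_degree_lt (fun h0 => by simp [h0] at hα)).2 hRdeg)) hα'
  refine ⟨b, √(R.coeff n), C (R.coeff n)⁻¹ * R, Real.sqrt_pos.2 hα, ?_, ?_, ?_, hRpos.splits, ?_⟩
  · rw [Monic, leadingCoeff_mul, leadingCoeff_C, leadingCoeff, hRn]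
    exact inv_mul_cancel₀ hα'
  · rw [natDegree_C_mul (inv_ne_zero hα'), hRn]
  · rw [Real.sq_sqrt hα.le, ← mul_assoc, ← C_mul, mul_inv_cancel₀ hα', C_1, hR]
    ring
  · intro x hx
    rw [eval_mul, eval_C]
    have := mul_pos (inv_pos.2 hα) (hRpos.pos x hx)
    linarith

end PositiveResidues

/-- A monic polynomial is recovered uniquely from one Euclidean step. -/
theorem euclid_step_unique {q r r' : ℝ[X]} {b b' c c' : ℝ} (hr : r.Monic) (hr' : r'.Monic)
    (hrq : r.degree < q.degree) (hrq' : r'.degree < q.degree) (hc : c ≠ 0)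
    (hc' : c' ≠ 0)
    (h : (X - C b) * q - C c * r = (X - C b') * q - C c' * r') : b = b' ∧ c = c' ∧ r = r' := by
  have h1 : C (b' - b) * q = C c * r - C c' * r' := by
    rw [C_sub]; linear_combination h
  have hb : b' - b = 0 := by
    by_contra h0
    have h2 : (C (b' - b) * q).degree = q.degree := degree_C_mul h0
    rw [h1] at h2
    exact ((degree_sub_le _ _).trans_lt (max_lt ((degree_C_mul hc).trans_lt hrq)
      ((degree_C_mul hc').trans_lt hrq'))).ne h2
  rw [hb, C_0, zero_mul, eq_comm, sub_eq_zero] at h1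
  have hcc : c = c' := by
    have := congrArg leadingCoeff h1
    simpa [hr.leadingCoeff, hr'.leadingCoeff] using this
  subst hcc
  exact ⟨by linarith, rfl, mul_left_cancel₀ (C_ne_zero.2 hc) h1⟩

end Polynomial

/-! ### The inverse spectral problem for Jacobi matrices -/

open Polynomial in
/-- The inverse spectral problem for Jacobi matrices: existence. -/
theorem exists_jacobiMatrix {N : ℕ} (p q : ℝ[X]) (hp : p.Monic) (hq : q.Monic)
    (hpn : p.natDegree = N + 1) (hqn : q.natDegree = N) (h : PositiveResidues p q) :
    ∃ (a : Fin N → ℝ) (b : Fin (N + 1) → ℝ), (∀ j, 0 < a j) ∧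
      (jacobiMatrix a b).charpoly = p ∧ jacobiMinorPoly a b = q := by
  induction N generalizing p q with
  | zero =>
    refine ⟨Fin.elim0, fun _ => -p.coeff 0, fun j => j.elim0, ?_, ?_⟩
    · rw [Polynomial.Monic.eq_X_add_C hp hpn]
      rw [jacobiMatrix_charpoly_zero]
      simp
    · rw [eq_one_of_monic_natDegree_zero hq hqn]
      simp [jacobiMinorPoly]
  | succ N ih =>
    obtain ⟨b, a, r, ha, hr, hrn, hpq, hqr⟩ := h.exists_euclid_step hp hq hpn hqn
    obtain ⟨a', b', ha', h1, h2⟩ := ih q r hq hr hqn hrn hqr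
    refine ⟨Fin.cons a a', Fin.cons b b', fun j => ?_, ?_, ?_⟩
    · refine Fin.cases ?_ (fun i => ?_) j
      · simpa using ha
      · simpa using ha' i
    · rw [jacobiMatrix_charpoly_succ, jacobiMinorPoly_succ, Fin.tail_cons, Fin.tail_cons, h1, h2,
        hpq, Fin.cons_zero, Fin.cons_zero]
    · rw [jacobiMinorPoly_succ, Fin.tail_cons, Fin.tail_cons, h1]

open Polynomial in
/-- The inverse spectral problem for Jacobi matrices: uniqueness. -/
theorem jacobiMatrix_unique {N : ℕ} (a a' : Fin N → ℝ) (b b' : Fin (N + 1) → ℝ)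
    (ha : ∀ j, 0 < a j) (ha' : ∀ j, 0 < a' j)
    (hp : (jacobiMatrix a b).charpoly = (jacobiMatrix a' b').charpoly)
    (hq : jacobiMinorPoly a b = jacobiMinorPoly a' b') : a = a' ∧ b = b' := by
  induction N with
  | zero =>
    refine ⟨Subsingleton.elim _ _, ?_⟩
    rw [jacobiMatrix_charpoly_zero, jacobiMatrix_charpoly_zero] at hp
    have := congrArg (eval 0) hp
    ext i
    rw [Fin.fin_one_eq_zero i]
    simpa using this
  | succ N ih =>
    have hdeg : ∀ (c : Fin (N + 1) → ℝ) (d : Fin (N + 2) → ℝ),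
        (jacobiMinorPoly (Fin.tail c) (Fin.tail d)).degree < (jacobiMinorPoly c d).degree := by
      intro c d
      rw [degree_eq_natDegree (jacobiMinorPoly_monic _ _).ne_zero,
        degree_eq_natDegree (jacobiMinorPoly_monic _ _).ne_zero, jacobiMinorPoly_natDegree,
        jacobiMinorPoly_natDegree]
      exact_mod_cast Nat.lt_succ_self _
    rw [jacobiMatrix_charpoly_succ, jacobiMatrix_charpoly_succ, ← hq] at hp
    obtain ⟨h1, h2, h3⟩ := euclid_step_unique (jacobiMinorPoly_monic _ _)
      (jacobiMinorPoly_monic _ _) (hdeg a b)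
      (hq ▸ hdeg a' b') (pow_pos (ha 0) 2).ne' (pow_pos (ha' 0) 2).ne' hp
    rw [jacobiMinorPoly_succ, jacobiMinorPoly_succ] at hq
    obtain ⟨h4, h5⟩ := ih (Fin.tail a) (Fin.tail a') (Fin.tail b) (Fin.tail b') (fun j => ha _)
      (fun j => ha' _) hq h3
    have h6 : a 0 = a' 0 := (pow_left_inj₀ (ha 0).le (ha' 0).le two_ne_zero).1 h2
    exact ⟨by rw [← Fin.cons_self_tail a, ← Fin.cons_self_tail a', h4, h6],
      by rw [← Fin.cons_self_tail b, ← Fin.cons_self_tail b', h5, h1]⟩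

/-! ### Real and imaginary parts of complex polynomials -/

namespace Polynomial

theorem exists_re_add_im (G : ℂ[X]) :
    ∃ U V : ℝ[X], G = U.map ofRealHom + C I * V.map ofRealHom := by
  induction G using Polynomial.induction_on' with
  | add p q hp hq =>
    obtain ⟨U, V, rfl⟩ := hp
    obtain ⟨U', V', rfl⟩ := hq
    exact ⟨U + U', V + V', by simp only [Polynomial.map_add]; ring⟩
  | monomial n a =>
    refine ⟨monomial n a.re, monomial n a.im, ?_⟩
    rw [map_monomial, map_monomial, C_mul_monomial, ← map_add]
    congr 1
    simp [mul_comm I]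

theorem coeff_re_add_im (U V : ℝ[X]) (n : ℕ) :
    (U.map ofRealHom + C I * V.map ofRealHom).coeff n = U.coeff n + I * V.coeff n := by
  simp

theorem eval_re_add_im (U V : ℝ[X]) (x : ℝ) :
    (U.map ofRealHom + C I * V.map ofRealHom).eval (x : ℂ) = U.eval x + I * V.eval x := by
  have h : ∀ W : ℝ[X], (W.map ofRealHom).eval (x : ℂ) = (W.eval x : ℝ) := fun W => by
    rw [← ofRealHom_eq_coe, eval_map_apply, ofRealHom_eq_coe]
  rw [eval_add, eval_mul, eval_C, h, h]

theorem re_add_im_injective {U V U' V' : ℝ[X]}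
    (h : U.map ofRealHom + C I * V.map ofRealHom = U'.map ofRealHom + C I * V'.map ofRealHom) :
    U = U' ∧ V = V' := by
  have hc : ∀ n, (U.coeff n : ℂ) + I * V.coeff n = U'.coeff n + I * V'.coeff n := fun n => by
    rw [← coeff_re_add_im, h, coeff_re_add_im]
  constructor <;> ext n
  · simpa using congrArg Complex.re (hc n)
  · simpa using congrArg Complex.im (hc n)

/-- The leading coefficient `1` is real, so it belongs entirely to `U`. -/
theorem monic_re_of_monic {U V : ℝ[X]} {n : ℕ}
    (hm : (U.map ofRealHom + C I * V.map ofRealHom).Monic)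
    (hn : (U.map ofRealHom + C I * V.map ofRealHom).natDegree = n) :
    U.Monic ∧ U.natDegree = n ∧ V.degree < n := by
  have hlead : (U.coeff n : ℂ) + I * V.coeff n = 1 := by
    rw [← coeff_re_add_im, ← hn]; exact hm.coeff_natDegree
  have hzero : ∀ m, n < m → (U.coeff m : ℂ) + I * V.coeff m = 0 := fun m hm' => by
    rw [← coeff_re_add_im]; exact coeff_eq_zero_of_natDegree_lt (hn ▸ hm')
  have hU1 : U.coeff n = 1 := by simpa using congrArg Complex.re hlead
  have hUle : U.natDegree ≤ n := natDegree_le_iff_coeff_eq_zero.2 fun m hm' => by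
    simpa using congrArg Complex.re (hzero m hm')
  refine ⟨monic_of_natDegree_le_of_coeff_eq_one n hUle hU1,
    natDegree_eq_of_le_of_coeff_ne_zero hUle (by rw [hU1]; exact one_ne_zero), ?_⟩
  rw [degree_lt_iff_coeff_zero]
  intro m hm'
  rcases eq_or_lt_of_le hm' with rfl | hlt
  · simpa using congrArg Complex.im hlead
  · simpa using congrArg Complex.im (hzero m hlt)

end Polynomial

/-! ### Crossing counts for the real part of a polynomial -/

section

open Polynomial

theorem isPhase_rootPhase {s : Multiset ℂ} (hs : ∀ z ∈ s, z.im ≠ 0) {U V : ℝ[X]}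
    (h : (s.map fun z => X - C z).prod = U.map ofRealHom + C I * V.map ofRealHom) :
    IsPhase (fun x => U.eval x) (fun x => V.eval x) (rootPhase s) := by
  refine ⟨U.differentiable, V.differentiable, continuous_rootPhase hs, fun x => ?_⟩
  obtain ⟨r, hr, hprod⟩ := exists_prod_sub_eq_mul_exp_rootPhase hs x
  have h1 := eval_re_add_im U V x
  rw [← h, eval_multiset_prod, Multiset.map_map] at h1
  simp only [Function.comp_def, eval_sub, eval_X, eval_C] at h1
  rw [hprod] at h1
  refine ⟨r, hr, ?_, ?_⟩
  · simpa [exp_ofReal_mul_I_re, exp_ofReal_mul_I_im] using (congrArg Complex.re h1).symm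
  · simpa [exp_ofReal_mul_I_re, exp_ofReal_mul_I_im] using (congrArg Complex.im h1).symm

theorem countP_im_add_countP_im {s : Multiset ℂ} (hs : ∀ z ∈ s, z.im ≠ 0) :
    s.countP (fun z => 0 < z.im) + s.countP (fun z => z.im < 0) = Multiset.card s := by
  rw [Multiset.card_eq_countP_add_countP (fun z : ℂ => 0 < z.im) s]
  congr 1
  refine Multiset.countP_congr rfl fun z hz => ?_
  rw [not_lt]
  exact propext ⟨le_of_lt, fun h => lt_of_le_of_ne h (hs z hz)⟩

theorem card_filter_toFinset_of_nodup {s : Multiset ℝ} (hs : s.Nodup) (p : ℝ → Prop)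
    [DecidablePred p] : (s.toFinset.filter p).card = s.countP p := by
  rw [Finset.card, Finset.filter_val, Multiset.toFinset_val, hs.dedup,
    Multiset.countP_eq_card_filter]

theorem card_filter_gt_add_card_filter_lt {S : Finset ℝ} {ξ : ℝ} (h : ξ ∉ S) :
    (S.filter (ξ < ·)).card + (S.filter (· < ξ)).card = S.card := by
  rw [← Finset.card_filter_add_card_filter_not (s := S) (ξ < ·)]
  congr 2
  refine Finset.filter_congr fun x hx => ?_
  rw [not_lt]
  exact ⟨le_of_lt, fun h' => lt_of_le_of_ne h' fun h0 => h (h0 ▸ hx)⟩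

variable {s : Multiset ℂ} {U V : ℝ[X]} {ξ : ℝ}

theorem mem_filter_roots_gt (hU : U ≠ 0) (x : ℝ) :
    x ∈ U.roots.toFinset.filter (ξ < ·) ↔ ξ < x ∧ U.eval x = 0 := by
  simp [hU, and_comm]

theorem mem_filter_roots_lt (hU : U ≠ 0) (x : ℝ) :
    x ∈ U.roots.toFinset.filter (· < ξ) ↔ x < ξ ∧ U.eval x = 0 := by
  simp [hU, and_comm]

/-- If the real part `U` of `∏ (X - z_j)` has only real roots, crossed by the phase in the
prescribed directions, then the phase at `ξ` is small and the half-plane counts agree. -/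
theorem rootPhase_lt_and_counts (hs : ∀ z ∈ s, z.im ≠ 0) (hs0 : s ≠ 0)
    (hG : (s.map fun z => X - C z).prod = U.map ofRealHom + C I * V.map ofRealHom)
    (hU : U ≠ 0) (hsplit : U.Splits) (hdeg : U.natDegree = Multiset.card s)
    (hroots : ∀ x, U.IsRoot x → (x - ξ) * ((derivative U).eval x * V.eval x) < 0)
    (hξ : U.eval ξ ≠ 0) :
    rootPhase s ξ < Real.pi / 2 ∧
      U.roots.countP (fun x => ξ < x) = s.countP (fun z => 0 < z.im) ∧
      U.roots.countP (fun x => x < ξ) = s.countP (fun z => z.im < 0) := by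
  have hph := isPhase_rootPhase hs hG
  have hpi := Real.pi_pos
  have hnod : U.roots.Nodup := nodup_roots_of_derivative_ne_zero hU fun x hx h0 => by
    have := hroots x hx; simp [h0] at this
  obtain ⟨k, hk⟩ := exists_abs_sub_int_mul_pi_lt ((hph.cos_ne_zero_iff ξ).2 hξ)
  obtain ⟨-, h1⟩ := hph.count_right (tendsto_rootPhase_atTop hs) _ ξ k hk
    (mem_filter_roots_gt hU)
  obtain ⟨-, h2⟩ := hph.count_left (tendsto_rootPhase_atBot hs) _ ξ k hk
    (mem_filter_roots_lt hU)
  simp only [Polynomial.deriv] at h1 h2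
  have h1' := h1 fun x hx => by
    obtain ⟨hx1, hx2⟩ := (mem_filter_roots_gt hU x).1 hx
    exact (mul_neg_iff.1 (hroots x hx2)).elim (fun h => h.2) fun h => by linarith
  have h2' := h2 fun x hx => by
    obtain ⟨hx1, hx2⟩ := (mem_filter_roots_lt hU x).1 hx
    exact (mul_neg_iff.1 (hroots x hx2)).elim (fun h => by linarith) fun h => h.2
  have h3 := countP_im_add_countP_im hs
  have h4 := card_filter_gt_add_card_filter_lt (S := U.roots.toFinset) (ξ := ξ)
    (by simp [hU, hξ])
  rw [Multiset.toFinset_card_of_nodup hnod, ← hsplit.natDegree_eq_card_roots, hdeg] at h4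
  -- A negative `k` would put the positive number `rootPhase s ξ` below `-π/2`.
  have hkpos : 0 ≤ k := by
    by_contra! hneg
    have h5 : (k : ℝ) ≤ -1 := by exact_mod_cast Int.le_sub_one_of_lt hneg
    have h6 := rootPhase_pos hs hs0 ξ
    have h7 := (abs_lt.1 hk).2
    nlinarith
  rw [card_filter_toFinset_of_nodup hnod] at h1' h2' h4
  rw [card_filter_toFinset_of_nodup hnod] at h4
  -- Adding the bounds for the two sides gives `2k + deg U ≤ card s`, hence `k ≤ 0`. With `k = 0`
  -- both bounds become equalities.
  have hk0 : k = 0 := by omega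
  subst hk0
  refine ⟨by simpa using (abs_lt.1 hk).2, by omega, by omega⟩

/-- If the phase at `ξ` is small, then the real part `U` of `∏ (X - z_j)` has only real roots,
crossed by the phase in the prescribed directions. -/
theorem splits_of_rootPhase_lt (hs : ∀ z ∈ s, z.im ≠ 0) (hs0 : s ≠ 0)
    (hG : (s.map fun z => X - C z).prod = U.map ofRealHom + C I * V.map ofRealHom)
    (hU : U ≠ 0) (hdeg : U.natDegree = Multiset.card s) (hξ : rootPhase s ξ < Real.pi / 2) :
    U.Splits ∧ U.eval ξ ≠ 0 ∧
      ∀ x, U.IsRoot x → (x - ξ) * ((derivative U).eval x * V.eval x) < 0 := by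
  have hph := isPhase_rootPhase hs hG
  have hk : |rootPhase s ξ - (0 : ℤ) * Real.pi| < Real.pi / 2 := by
    rw [abs_lt]
    have := rootPhase_pos hs hs0 ξ
    have := Real.pi_pos
    constructor <;> push_cast <;> linarith
  have hUξ : U.eval ξ ≠ 0 :=
    (hph.cos_ne_zero_iff ξ).1 (cos_ne_zero_of_abs_sub_int_mul_pi_lt hk)
  obtain ⟨h1, -⟩ := hph.count_right (tendsto_rootPhase_atTop hs) _ ξ 0 hk
    (mem_filter_roots_gt hU)
  obtain ⟨h2, -⟩ := hph.count_left (tendsto_rootPhase_atBot hs) _ ξ 0 hk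
    (mem_filter_roots_lt hU)
  simp only [Polynomial.deriv] at h1 h2
  have h3 := countP_im_add_countP_im hs
  have h4 := card_filter_gt_add_card_filter_lt (S := U.roots.toFinset) (ξ := ξ)
    (by simp [hU, hUξ])
  have h5 := Finset.card_filter_le (U.roots.toFinset.filter (ξ < ·))
    fun x => ¬ 0 < (derivative U).eval x * V.eval x
  have h6 := Finset.card_filter_le (U.roots.toFinset.filter (· < ξ))
    fun x => ¬ (derivative U).eval x * V.eval x < 0
  have h7 := U.roots.toFinset_card_le
  have h8 := U.card_roots'
  -- The chain `card s ≤` counted crossings `≤` distinct roots `≤ deg U = card s` collapses, so all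
  -- roots are real, simple and not crossed in the wrong direction.
  have hnod : U.roots.Nodup := Multiset.toFinset_card_eq_card_iff_nodup.1 (by omega)
  have hr := Finset.card_filter_eq_iff.1 (show (Finset.filter
    (fun x => ¬ 0 < (derivative U).eval x * V.eval x) _).card = _ from le_antisymm h5 (by omega))
  have hl := Finset.card_filter_eq_iff.1 (show (Finset.filter
    (fun x => ¬ (derivative U).eval x * V.eval x < 0) _).card = _ from le_antisymm h6 (by omega))
  refine ⟨splits_iff_card_roots.2 (by omega), hUξ, fun x hx => ?_⟩
  have hder : (derivative U).eval x ≠ 0 := fun h0 => by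
    have := (one_lt_rootMultiplicity_iff_isRoot hU).2 ⟨hx, h0⟩
    rw [← count_roots] at this
    exact absurd (Multiset.nodup_iff_count_le_one.1 hnod x) (not_le.2 this)
  have hV : V.eval x ≠ 0 := fun h0 => by
    obtain ⟨r, hr, h1, h2⟩ := hph.polar x
    have h1' : Real.cos (rootPhase s x) = 0 := by
      simpa [hr, show U.eval x = 0 from hx] using h1
    have h2' : Real.sin (rootPhase s x) = 0 := by simpa [hr, h0] using h2
    have := Real.sin_sq_add_cos_sq (rootPhase s x)
    simp [h1', h2'] at this
  have hne := mul_ne_zero hder hV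
  rcases lt_trichotomy x ξ with h | h | h
  · have := hl x ((mem_filter_roots_lt hU x).2 ⟨h, hx⟩)
    exact mul_neg_of_neg_of_pos (by linarith) (lt_of_le_of_ne (not_lt.1 this) hne.symm)
  · exact absurd (h ▸ hx) hUξ
  · have := hr x ((mem_filter_roots_gt hU x).2 ⟨h, hx⟩)
    exact mul_neg_of_pos_of_neg (by linarith) (lt_of_le_of_ne (not_lt.1 this) hne)

/-- For a phase at `ξ` in `(0, π/2)`, comparison with `arctan A`. -/
theorem rootPhase_lt_arctan_iff (hs : ∀ z ∈ s, z.im ≠ 0) (hs0 : s ≠ 0)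
    (hG : (s.map fun z => X - C z).prod = U.map ofRealHom + C I * V.map ofRealHom)
    (hξ : rootPhase s ξ < Real.pi / 2) {A : ℝ} :
    rootPhase s ξ < Real.arctan A ↔ 0 < U.eval ξ * (A * U.eval ξ - V.eval ξ) := by
  obtain ⟨r, hr, h1, h2⟩ := (isPhase_rootPhase hs hG).polar ξ
  have hpos := rootPhase_pos hs hs0 ξ
  have hpi := Real.pi_pos
  have hcos : 0 < Real.cos (rootPhase s ξ) :=
    Real.cos_pos_of_mem_Ioo ⟨by linarith, hξ⟩
  rw [← Real.arctan_tan (x := rootPhase s ξ) (by linarith) hξ, Real.arctan_lt_arctan_iff,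
    Real.tan_eq_sin_div_cos, div_lt_iff₀ hcos]
  have : U.eval ξ * (A * U.eval ξ - V.eval ξ)
      = (r ^ 2 * Real.cos (rootPhase s ξ)) *
        (A * Real.cos (rootPhase s ξ) - Real.sin (rootPhase s ξ)) := by
    rw [show U.eval ξ = _ from h1, show V.eval ξ = _ from h2]; ring
  rw [this, mul_pos_iff_of_pos_left (by positivity), sub_pos]

end

/-! ### The direct and inverse problems for `J_{l,m}` -/

section

open Polynomial

theorem det_sub_scalar_eq_zero_iff {n : ℕ} (M : Matrix (Fin n) (Fin n) ℝ) (x : ℝ) :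
    (M - Matrix.scalar (Fin n) x).det = 0 ↔ M.charpoly.IsRoot x := by
  rw [IsRoot, Matrix.eval_charpoly, ← neg_sub, Matrix.det_neg]
  simp

theorem derivative_X_sub_C_mul_eval (U : ℝ[X]) (ξ x : ℝ) :
    (derivative ((X - C ξ) * U)).eval x = U.eval x + (x - ξ) * (derivative U).eval x := by
  simp

/-- The roots of `p + i A (p - (X - ξ) q)` for a real-rooted polynomial `p` vanishing at `ξ` whose
Wronskian with `q` is positive. -/
theorem exists_roots_eq_cons {k : ℕ} {p q : ℝ[X]} {F : ℂ[X]} {ξ A : ℝ} (hA : 0 < A)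
    (hpm : p.Monic) (hpd : p.natDegree = k + 2) (hps : p.Splits) (hpξ : p.IsRoot ξ)
    (hW : ∀ x, 0 < (derivative p).eval x * q.eval x - p.eval x * (derivative q).eval x)
    (hFm : F.Monic) (hFd : F.natDegree = k + 2)
    (hF : F = p.map ofRealHom + C (I * A) * (p - (X - C ξ) * q).map ofRealHom) :
    ∃ s ∈ configurations (k + 1) ξ A, F.roots = (ξ : ℂ) ::ₘ s ∧
      p.roots.countP (fun x => ξ < x) = s.countP (fun z => 0 < z.im) ∧
      p.roots.countP (fun x => x < ξ) = s.countP (fun z => z.im < 0) := by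
  obtain ⟨U, hU⟩ := dvd_iff_isRoot.2 hpξ
  have hUm : U.Monic := (monic_X_sub_C ξ).of_mul_monic_left (hU ▸ hpm)
  have hUd : U.natDegree = k + 1 := by
    rw [hU, (monic_X_sub_C ξ).natDegree_mul hUm, natDegree_X_sub_C] at hpd
    omega
  have hproots : p.roots = ξ ::ₘ U.roots := by
    rw [hU, roots_mul (hU ▸ hpm.ne_zero), roots_X_sub_C]
    rfl
  have hUs : U.Splits := by
    rw [splits_iff_card_roots] at hps ⊢
    rw [hproots, Multiset.card_cons, hpd] at hps
    omega
  -- Positivity of the Wronskian at the zeros of `p`, with `p'` written in terms of `U`.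
  have hpos : ∀ x, ((X - C ξ) * U).IsRoot x →
      0 < (U.eval x + (x - ξ) * (derivative U).eval x) * q.eval x := fun x hx => by
    have h := hW x
    rw [hU, derivative_X_sub_C_mul_eval, show eval x ((X - C ξ) * U) = 0 from hx] at h
    linarith
  set V := C A * (U - q) with hV
  set G := U.map ofRealHom + C I * V.map ofRealHom with hG
  have hFG : F = (X - C (ξ : ℂ)) * G := by
    rw [hF, hU, hG, hV]
    simp only [Polynomial.map_sub, Polynomial.map_mul, Polynomial.map_X, Polynomial.map_C, C_mul,
      ofRealHom_eq_coe]
    ring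
  have hGm : G.Monic := (monic_X_sub_C (ξ : ℂ)).of_mul_monic_left (hFG ▸ hFm)
  have hGd : G.natDegree = k + 1 := by
    rw [hFG, (monic_X_sub_C (ξ : ℂ)).natDegree_mul hGm, natDegree_X_sub_C] at hFd
    omega
  have hGs : G.Splits := IsAlgClosed.splits G
  have hcard : Multiset.card G.roots = k + 1 := by rw [← hGs.natDegree_eq_card_roots, hGd]
  have hprod : (G.roots.map fun z => X - C z).prod = G := (hGs.eq_prod_roots_of_monic hGm).symm
  -- A real root of `G` is a common zero of `U` and `V`, hence of `p` and `q`, where the Wronskian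
  -- would vanish.
  have hnonreal : ∀ z ∈ G.roots, z.im ≠ 0 := fun z hz him => by
    have hzr : z = (z.re : ℂ) := by apply Complex.ext <;> simp [him]
    have h0 := isRoot_of_mem_roots hz
    rw [IsRoot, hzr, hG, eval_re_add_im] at h0
    have h1 : U.eval z.re = 0 := by simpa using congrArg Complex.re h0
    have h2 : V.eval z.re = 0 := by simpa using congrArg Complex.im h0
    have h3 : q.eval z.re = 0 := by
      rw [hV, eval_mul, eval_C, eval_sub, h1] at h2
      simpa [hA.ne'] using h2
    have := hpos z.re (by rw [IsRoot, eval_mul, h1, mul_zero])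
    simp [h3] at this
  have hG0 : G.roots ≠ 0 := fun h0 => by simp [h0] at hcard
  have hξpos : 0 < U.eval ξ * q.eval ξ := by
    have := hpos ξ (by rw [IsRoot, eval_mul]; simp)
    simpa using this
  have hUξ : U.eval ξ ≠ 0 := fun h0 => by simp [h0] at hξpos
  obtain ⟨h1, h2, h3⟩ := rootPhase_lt_and_counts (ξ := ξ) hnonreal hG0 hprod hUm.ne_zero hUs
    (by rw [hUd, hcard]) (fun x hx => by
      have hx' : U.eval x = 0 := hx
      have h := hpos x (by rw [IsRoot, eval_mul, hx', mul_zero])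
      rw [hx', zero_add] at h
      rw [hV, eval_mul, eval_C, eval_sub, hx']
      nlinarith [mul_pos hA h]) hUξ
  refine ⟨G.roots, ⟨hcard, hnonreal, ?_⟩, ?_, ?_, ?_⟩
  -- At `ξ`, `A U - V = A q`.
  · refine (rootPhase_lt_arctan_iff hnonreal hG0 hprod h1).2 ?_
    rw [hV, eval_mul, eval_C, eval_sub]
    nlinarith [mul_pos hA hξpos]
  · rw [hFG, roots_mul (hFG ▸ hFm.ne_zero), roots_X_sub_C]
    rfl
  · rw [hproots, Multiset.countP_cons_of_neg _ (lt_irrefl _), h2]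
  · rw [hproots, Multiset.countP_cons_of_neg (p := fun x => x < ξ) _ (lt_irrefl _), h3]

namespace RankTwoData

theorem ratio_pos {k : ℕ} (P : RankTwoData k) : 0 < P.ratio := div_pos P.m_pos (P.a_pos 0)

/-- The remaining eigenvalues of `J_{l,m}` and their properties. -/
theorem exists_spectrum {k : ℕ} (P : RankTwoData k)
    (hdet : (P.J - Matrix.scalar (Fin (k + 2)) P.xi).det = 0) :
    ∃ s ∈ configurations (k + 1) P.xi P.ratio,
      eigenvalueMultiset P.Jlm = (P.xi : ℂ) ::ₘ s ∧
      (eigenvalueMultiset P.J).countP (fun x => P.xi < x) = s.countP (fun z => 0 < z.im) ∧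
      (eigenvalueMultiset P.J).countP (fun x => x < P.xi) = s.countP (fun z => z.im < 0) := by
  exact exists_roots_eq_cons P.ratio_pos (Matrix.charpoly_monic _)
    (by simp [Matrix.charpoly_natDegree_eq_dim])
    (jacobiMatrix_isHermitian P.a P.b).splits_charpoly
    ((det_sub_scalar_eq_zero_iff _ _).1 hdet) (jacobi_wronskian_pos P.a P.b P.a_pos)
    (Matrix.charpoly_monic _) (by simp [Matrix.charpoly_natDegree_eq_dim]) P.charpoly_Jlm

/-- Real and imaginary parts of the characteristic polynomial determine `p` and, with `ξ` and `A`
known, `q`. These determine `a, b`; then `A` gives `m` and `ξ` gives `l`. -/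
theorem ext_of_spectrum {k : ℕ} {P Q : RankTwoData k} (hxi : P.xi = Q.xi)
    (hratio : P.ratio = Q.ratio) (h : eigenvalueMultiset P.Jlm = eigenvalueMultiset Q.Jlm) :
    P = Q := by
  have hchar : P.Jlm.charpoly = Q.Jlm.charpoly := by
    rw [(IsAlgClosed.splits P.Jlm.charpoly).eq_prod_roots_of_monic (Matrix.charpoly_monic _),
      (IsAlgClosed.splits Q.Jlm.charpoly).eq_prod_roots_of_monic (Matrix.charpoly_monic _)]
    unfold eigenvalueMultiset at h
    rw [h]
  have hform : ∀ R : RankTwoData k, R.Jlm.charpoly = R.J.charpoly.map ofRealHom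
      + C I * (C R.ratio * (R.J.charpoly - (X - C R.xi) * jacobiMinorPoly R.a R.b)).map
        ofRealHom := fun R => by
    rw [R.charpoly_Jlm, C_mul, Polynomial.map_mul, Polynomial.map_C, ofRealHom_eq_coe, mul_assoc]
  rw [hform, hform] at hchar
  obtain ⟨h1, h2⟩ := re_add_im_injective hchar
  rw [hratio, h1, hxi] at h2
  have h3 := mul_left_cancel₀ (C_ne_zero.2 Q.ratio_pos.ne') h2
  have h4 := mul_left_cancel₀ (X_sub_C_ne_zero _) (sub_right_injective h3)
  obtain ⟨ha, hb⟩ := jacobiMatrix_unique _ _ _ _ P.a_pos Q.a_pos h1 h4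
  have hm : P.m = Q.m := by
    rw [ratio, ratio, ha] at hratio
    exact (div_left_inj' (Q.a_pos 0).ne').1 hratio
  have hl : P.l = Q.l := by
    rw [xi, xi, ha, hb, hm] at hxi
    have h5 := (div_left_inj' Q.m_pos.ne').1 (sub_right_injective hxi)
    exact mul_right_cancel₀ (Q.a_pos 0).ne' h5
  cases P; cases Q
  simp only at ha hb hm hl
  subst ha hb hm hl
  rfl

theorem exists_of_configuration {k : ℕ} {ξ A : ℝ} (hA : 0 < A) {s : Multiset ℂ}
    (hs : s ∈ configurations (k + 1) ξ A) :
    ∃ P : RankTwoData k, P.xi = ξ ∧ P.ratio = A ∧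
      (P.J - Matrix.scalar (Fin (k + 2)) ξ).det = 0 ∧
      eigenvalueMultiset P.Jlm = (ξ : ℂ) ::ₘ s := by
  obtain ⟨hcard, hnr, hlt⟩ := hs
  change rootPhase s ξ < Real.arctan A at hlt
  have hs0 : s ≠ 0 := fun h0 => by simp [h0] at hcard
  obtain ⟨U, V, hG⟩ := exists_re_add_im (s.map fun z => X - C z).prod
  have hGm : (s.map fun z => X - C z).prod.Monic := monic_multisetProd_X_sub_C s
  have hGd : (s.map fun z => X - C z).prod.natDegree = k + 1 := by
    rw [natDegree_multiset_prod_X_sub_C_eq_card, hcard]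
  obtain ⟨hUm, hUd, hVd⟩ := monic_re_of_monic (hG ▸ hGm) (hG ▸ hGd)
  have hlt' := hlt.trans (Real.arctan_lt_pi_div_two A)
  obtain ⟨hUs, hUξ, hroots⟩ := splits_of_rootPhase_lt hnr hs0 hG hUm.ne_zero
    (by rw [hUd, hcard]) hlt'
  have hξ := (rootPhase_lt_arctan_iff hnr hs0 hG hlt').1 hlt
  have hUdeg : U.degree = (k + 1 : ℕ) := by rw [degree_eq_natDegree hUm.ne_zero, hUd]
  have hVdeg : (C A⁻¹ * V).degree < U.degree := by
    rw [degree_C_mul (inv_ne_zero hA.ne'), hUdeg]; exact hVd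
  -- The minor must be `q = U - V / A`, which is `V = A(U - q)` solved for `q`.
  have hqm : (U - C A⁻¹ * V).Monic := hUm.sub_of_left hVdeg
  have hqd : (U - C A⁻¹ * V).natDegree = k + 1 := by
    rw [natDegree_eq_of_degree_eq (degree_sub_eq_left_of_degree_lt hVdeg), hUd]
  have hpm := (monic_X_sub_C ξ).mul hUm
  have hpd : ((X - C ξ) * U).natDegree = k + 2 := by
    rw [(monic_X_sub_C ξ).natDegree_mul hUm, natDegree_X_sub_C, hUd]; omega
  have hres : PositiveResidues ((X - C ξ) * U) (U - C A⁻¹ * V) := by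
    refine ⟨(Splits.X_sub_C ξ).mul hUs, fun x hx => ?_⟩
    rw [derivative_X_sub_C_mul_eval, eval_sub, eval_mul, eval_C]
    -- At `ξ` positivity is the `arctan A` bound; at the zeros of `U`, where `q = -V / A`, it is the
    -- crossing direction.
    rcases mul_eq_zero.1 (show (X - C ξ).eval x * U.eval x = 0 by rw [← eval_mul]; exact hx)
      with h | h
    · have hxξ : x = ξ := by simpa [sub_eq_zero] using h
      subst hxξ
      have := mul_pos (inv_pos.2 hA) hξ
      refine this.trans_eq ?_
      linear_combination (U.eval x) ^ 2 * inv_mul_cancel₀ hA.ne'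
    · have := mul_pos (inv_pos.2 hA) (neg_pos.2 (hroots x h))
      rw [h]
      linarith
  obtain ⟨a, b, ha, hJ, hminor⟩ := exists_jacobiMatrix _ _ hpm hqm hpd hqd hres
  have ha0 := (ha 0).ne'
  -- The values of `l` and `m` solve `b₀ - l a₀ / m = ξ` and `m / a₀ = A`.
  let P : RankTwoData k := ⟨a, b, (b 0 - ξ) * A, A * a 0, ha, mul_pos hA (ha 0)⟩
  have hxi : P.xi = ξ := by
    change b 0 - (b 0 - ξ) * A * a 0 / (A * a 0) = ξ
    field_simp
    ring
  have hratio : P.ratio = A := by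
    change A * a 0 / a 0 = A
    field_simp
  have hPJ : P.J.charpoly = (X - C ξ) * U := hJ
  refine ⟨P, hxi, hratio, ?_, ?_⟩
  · rw [det_sub_scalar_eq_zero_iff, hPJ, IsRoot, eval_mul]
    simp
  · have hchar : P.Jlm.charpoly = (X - C (ξ : ℂ)) * (s.map fun z => X - C z).prod := by
      have hAC : (C (A : ℂ)) * C (A : ℂ)⁻¹ = 1 := by
        rw [← C_mul, mul_inv_cancel₀ (by exact_mod_cast hA.ne'), C_1]
      rw [P.charpoly_Jlm, hxi, hratio, hPJ, show jacobiMinorPoly P.a P.b = _ from hminor, hG]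
      simp only [Polynomial.map_sub, Polynomial.map_mul, Polynomial.map_X, Polynomial.map_C, C_mul,
        ofRealHom_eq_coe, ofReal_inv]
      linear_combination (C I * (X - C (ξ : ℂ)) * V.map ofRealHom) * hAC
    rw [eigenvalueMultiset, hchar, roots_mul
      ((monic_X_sub_C (ξ : ℂ)).mul hGm).ne_zero, roots_X_sub_C, roots_multiset_prod_X_sub_C]
    rfl

end RankTwoData

end

theorem theorem5p4 (k : ℕ) :
    -- the direct problem
    (∀ P : RankTwoData k, (P.J - Matrix.scalar (Fin (k + 2)) P.xi).det = 0 →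
      (eigenvalueMultiset P.Jlm).count (P.xi : ℂ) = 1 ∧
      (eigenvalueMultiset P.Jlm).erase (P.xi : ℂ) ∈ configurations (k + 1) P.xi P.ratio) ∧
    -- the inverse problem
    (∀ ξ A : ℝ, 0 < A → ∀ s ∈ configurations (k + 1) ξ A,
      ∃! P : RankTwoData k, P.xi = ξ ∧ P.ratio = A ∧
        (P.J - Matrix.scalar (Fin (k + 2)) ξ).det = 0 ∧
        eigenvalueMultiset P.Jlm = (ξ : ℂ) ::ₘ s) ∧
    -- the half-plane counts
    (∀ P : RankTwoData k, (P.J - Matrix.scalar (Fin (k + 2)) P.xi).det = 0 →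
      (eigenvalueMultiset P.J).countP (fun x => P.xi < x) =
          (eigenvalueMultiset P.Jlm).countP (fun z => 0 < z.im) ∧
        (eigenvalueMultiset P.J).countP (fun x => x < P.xi) =
          (eigenvalueMultiset P.Jlm).countP (fun z => z.im < 0)) := by
  have hzero : ∀ (s : Multiset ℂ) (ξ : ℝ), (∀ z ∈ s, z.im ≠ 0) → (ξ : ℂ) ∉ s :=
    fun s ξ hs h => hs _ h (ofReal_im ξ)
  refine ⟨fun P hdet => ?_, fun ξ A hA s hs => ?_, fun P hdet => ?_⟩
  · obtain ⟨s, hs, hspec, -⟩ := P.exists_spectrum hdet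
    rw [hspec, Multiset.count_cons_self, Multiset.erase_cons_head,
      Multiset.count_eq_zero_of_notMem (hzero s P.xi hs.2.1)]
    exact ⟨rfl, hs⟩
  · obtain ⟨P, h1, h2, h3, h4⟩ := RankTwoData.exists_of_configuration hA hs
    refine ⟨P, ⟨h1, h2, h3, h4⟩, fun Q ⟨h1', h2', _, h4'⟩ => ?_⟩
    exact RankTwoData.ext_of_spectrum (h1'.trans h1.symm) (h2'.trans h2.symm) (h4'.trans h4.symm)
  · obtain ⟨s, -, hspec, h1, h2⟩ := P.exists_spectrum hdet
    rw [hspec, Multiset.countP_cons_of_neg _ (by simp), Multiset.countP_cons_of_neg _ (by simp)]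
    exact ⟨h1, h2⟩
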